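/- An \emph{ordered probability space} $(S,\mathcal F,\mu,\vartriangleleft)$ is a probability space $(S,\mathcal F,\mu)$ with a strict (irreflexive and transitive) order relation $\vartriangleleft$ on $S$ such that $\{(x,y): x\vartriangleleft y\}$ belongs to the product $\sigma$-algebra $\mathcal F\otimes\mathcal F$. A \emph{(poset) kernel} is a tuple $(S,\mathcal F,\mu,\vartriangleleft,W)$ where $(S,\mathcal F,\mu,\vartriangleleft)$ is an ordered probability space and $W:S\times S\to[0,1]$ is an $\mathcal F\otimes\mathcal F$-measurable function such that, for all $x,y,z\in S$, (i) $W(x,y)>0$ implies $x\vartriangleleft y$, and (ii) $W(x,y)>0$ and $W(y,z)>0$ imply $W(x,z)=1$. The kernel is \emph{strict} if moreover $W(x,y)>0$ for all $x,y\in S$ with $x\vartriangleleft y$. The space $(S,\mathcal F,\mu)$ is \emph{atomless} if every $A\in\mathcal F$ with $\mu(A)>0$ has a subset $B\in\mathcal F$ with $0<\mu(B)<\mu(A)$. An \emph{inclusion} of an ordered probability space $(S,\mathcal F,\mu,\vartriangleleft)$ into an ordered probability space $(S',\mathcal F',\mu',\vartriangleleft')$ is a (measurable) measure-preserving function $f:S\to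 S'$ such that the set $\{(x,y)\in S^2: x\vartriangleleft y,\ f(x)\not\vartriangleleft' f(y)\}$ has $\mu\otimes\mu$-measure zero. \textbf{Theorem.} Let $(S,\mathcal F,\mu,\vartriangleleft,W)$ be a strict kernel such that $(S,\mathcal F,\mu)$ is atomless. Then there are a kernel $([0,1],\mathcal B,\lambda,<,U)$, where $\mathcal B$ is the Borel $\sigma$-algebra, $\lambda$ is Lebesgue measure and $<$ is the usual order, and an inclusion $f:(S,\mathcal F,\mu,\vartriangleleft)\to([0,1],\mathcal B,\lambda,<)$ such that $W(x,y)=U(f(x),f(y))$ for $\mu\otimes\mu$-almost every $(x,y)\in S^2$. -/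

import Mathlib

open MeasureTheory

/-- An ordered probability space: a probability space `(S, 𝓕, μ)` with a strict order relation `r`
(irreflexive and transitive) whose graph is a measurable subset of `S × S` for `𝓕 ⊗ 𝓕`. -/
structure IsOrderedProbabilitySpace {S : Type*} [MeasurableSpace S] (μ : Measure S)
    (r : S → S → Prop) : Prop where
  isProbabilityMeasure : IsProbabilityMeasure μ
  isStrictOrder : IsStrictOrder S r
  measurableSet_rel : MeasurableSet {p : S × S | r p.1 p.2}

/-- `(S, 𝓕, μ, r, W)` is a (poset) kernel: `(S, 𝓕, μ, r)` is an ordered probability space and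
`W : S × S → [0, 1]` is an `𝓕 ⊗ 𝓕`-measurable function satisfying the two kernel axioms at all
points. -/
structure IsPosetKernel {S : Type*} [MeasurableSpace S] (μ : Measure S) (r : S → S → Prop)
    (W : S → S → ℝ) : Prop extends IsOrderedProbabilitySpace μ r where
  measurable : Measurable fun p : S × S => W p.1 p.2
  mem_Icc : ∀ x y, W x y ∈ Set.Icc (0 : ℝ) 1
  rel_of_pos : ∀ x y, 0 < W x y → r x y
  eq_one_of_pos : ∀ x y z, 0 < W x y → 0 < W y z → W x z = 1

/-- A kernel is strict if `W x y > 0` whenever `x` precedes `y`. -/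
structure IsStrictPosetKernel {S : Type*} [MeasurableSpace S] (μ : Measure S) (r : S → S → Prop)
    (W : S → S → ℝ) : Prop extends IsPosetKernel μ r W where
  pos_of_rel : ∀ x y, r x y → 0 < W x y

/-- A measure is atomless if every measurable set of positive measure has a measurable subset of
strictly smaller positive measure. (This is stronger than points having measure zero.) -/
def IsAtomless {S : Type*} [MeasurableSpace S] (μ : Measure S) : Prop :=
  ∀ A : Set S, MeasurableSet A → 0 < μ A → ∃ B ⊆ A, MeasurableSet B ∧ 0 < μ B ∧ μ B < μ A

/-- An inclusion of `(S, 𝓕, μ, r)` into `(S', 𝓕', μ', r')`: a measure-preserving map such that the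
set of pairs with `r x y` but not `r' (f x) (f y)` is null for `μ ⊗ μ`. -/
structure IsInclusion {S S' : Type*} [MeasurableSpace S] [MeasurableSpace S']
    (μ : Measure S) (r : S → S → Prop) (μ' : Measure S') (r' : S' → S' → Prop)
    (f : S → S') : Prop where
  measurePreserving : MeasurePreserving f μ μ'
  measure_bad_eq_zero : (μ.prod μ) {p : S × S | r p.1 p.2 ∧ ¬ r' (f p.1) (f p.2)} = 0

/-- The pull-back of a two-variable function `U` along `f`. -/
def kernelPullback {S S' : Type*} (U : S' → S' → ℝ) (f : S → S') : S → S → ℝ :=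
  fun x y => U (f x) (f y)

/-!
# Strict kernels on atomless spaces live on the unit interval

The task is to find a uniformly distributed `f : S → [0, 1]` which is almost order-preserving and
which nevertheless remembers everything that `W` depends on. Strictness makes both demands
compatible: if `x' ◁ x` and `W x y > 0`, then `W x' y = 1`, so `W` is antitone in its first and
monotone in its second variable. It is thus enough that `f` captures antitone functions on `S`,
and these can be captured by a monotone map.

* `W` factors through a measurable `g : S → (ℕ → Bool)`, which by atomlessness can be taken to have
  null fibres (`IsAtomless.exists_factor`). This makes the relevant `L¹` space separable without
  any regularity assumption on `S`.
* Countably many antitone functions are `L¹`-dense among all those factoring through `g`. Their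
  rational superlevel sets are down-sets, and writing the indicators of the complementary up-sets
  as ternary digits gives a weakly monotone `Φ : S → ℝ` of which every antitone function is almost
  everywhere a function (`exists_monotone_capturing_antitone`). In particular this holds for the
  negated down-set measure `x ↦ -μ {z | z ◁ x}`; that measure is strictly monotone outside a null
  set of pairs (`IsOrderedProbabilitySpace.ae_measure_down_ne`), and hence so is `Φ`.
* Spreading the atoms of `Φ` by means of `g` and applying the probability integral transform gives
  a uniformly distributed `f`, monotone along `Φ`, with `Φ` almost everywhere a function of `f`
  (`exists_measurePreserving_unitInterval`).
* Each section `W(·, y)` and `W(x, ·)` is now almost everywhere a function of `f`. Averaging over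
  the conditional distribution of `g` given `f` in both variables turns this into
  `W(x, y) = U(f x, f y)` almost everywhere (`exists_measurable_of_sections`).
* This `U` satisfies the kernel axioms only almost everywhere. Replacing `{U > 0}` and `{U = 1}` by
  their sets of Lebesgue density points makes the axioms hold at every point, since density points
  compose (`HasDensityZeroAt.comp`, `exists_kernel_of_ae`).
-/

/-! ### Countably generated factorisations -/

/-- The join of a sequence of Cantor-space-valued functions: a single Cantor-space-valued function
of which all members of the sequence are functions. -/
def cantorJoin {S : Type*} (g : ℕ → S → ℕ → Bool) : S → ℕ → Bool :=
  fun x k => g k.unpair.1 x k.unpair.2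

theorem measurable_cantorJoin {S : Type*} [MeasurableSpace S] {g : ℕ → S → ℕ → Bool}
    (hg : ∀ i, Measurable (g i)) : Measurable (cantorJoin g) :=
  measurable_pi_lambda _ fun k => (measurable_pi_apply k.unpair.2).comp (hg k.unpair.1)

theorem exists_measurable_eq_comp_cantorJoin {S : Type*} (g : ℕ → S → ℕ → Bool) (i : ℕ) :
    ∃ p : (ℕ → Bool) → (ℕ → Bool), Measurable p ∧ g i = p ∘ cantorJoin g :=
  ⟨fun c n => c (Nat.pair i n), measurable_pi_lambda _ fun _ => measurable_pi_apply _, by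
    funext x n; simp [cantorJoin]⟩

theorem comap_prodMap_le_cantorJoin {S : Type*} (g : ℕ → S → ℕ → Bool) (i : ℕ) :
    MeasurableSpace.comap (Prod.map (g i) (g i)) inferInstance ≤
      MeasurableSpace.comap (Prod.map (cantorJoin g) (cantorJoin g)) inferInstance := by
  obtain ⟨p, hp, hpg⟩ := exists_measurable_eq_comp_cantorJoin g i
  rintro _ ⟨A, hA, rfl⟩
  refine ⟨Prod.map p p ⁻¹' A, (hp.prodMap hp) hA, ?_⟩
  rw [← Set.preimage_comp, Prod.map_comp_map, ← hpg]

/-- Every measurable subset of `S × S` depends on countably many measurable sets only: it is the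
preimage of a Borel set under `g × g` for some measurable Cantor-space-valued `g`. -/
theorem exists_measurableSet_comap_prodMap {S : Type*} [MeasurableSpace S] {A : Set (S × S)}
    (hA : MeasurableSet A) : ∃ g : S → ℕ → Bool, Measurable g ∧
      MeasurableSet[MeasurableSpace.comap (Prod.map g g) inferInstance] A := by
  classical
  have hA' : MeasurableSet[MeasurableSpace.generateFrom
      (Set.image2 (· ×ˢ ·) {s : Set S | MeasurableSet s} {t : Set S | MeasurableSet t})] A := by
    rwa [generateFrom_prod]
  clear hA
  induction A, hA' using MeasurableSpace.generateFrom_induction with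
  | hC A hA _ =>
    obtain ⟨s, hs, t, ht, rfl⟩ := hA
    refine ⟨fun x n => if n = 0 then decide (x ∈ s) else decide (x ∈ t), ?_, ?_⟩
    · refine measurable_pi_lambda _ fun n => ?_
      by_cases hn : n = 0
      · simpa [hn] using measurable_to_bool (by simpa [Set.preimage] using hs)
      · simpa [hn] using measurable_to_bool (by simpa [Set.preimage] using ht)
    · refine ⟨{c | c 0 = true} ×ˢ {c | c 1 = true}, ?_, ?_⟩
      · exact (measurableSet_eq_fun (measurable_pi_apply 0) measurable_const).prod
          (measurableSet_eq_fun (measurable_pi_apply 1) measurable_const)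
      · ext ⟨x, y⟩; simp
  | empty => exact ⟨fun _ _ => true, measurable_const, MeasurableSpace.measurableSet_empty _⟩
  | compl A hA ih =>
    obtain ⟨g, hg, h⟩ := ih
    exact ⟨g, hg, h.compl⟩
  | iUnion A hA ih =>
    choose g hg h using ih
    exact ⟨cantorJoin g, measurable_cantorJoin hg,
      MeasurableSet.iUnion fun i => comap_prodMap_le_cantorJoin g i _ (h i)⟩

theorem Measurable.exists_measurable_comap_prodMap {S : Type*} [MeasurableSpace S] {F : S × S → ℝ}
    (hF : Measurable F) : ∃ g : S → ℕ → Bool, Measurable g ∧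
      Measurable[MeasurableSpace.comap (Prod.map g g) inferInstance] F := by
  choose g hg h using fun n : ℕ => exists_measurableSet_comap_prodMap
    (hF (measurableSet_Ioi (a := (((Denumerable.eqv ℚ).symm n : ℚ) : ℝ))))
  refine ⟨cantorJoin g, measurable_cantorJoin hg, ?_⟩
  rw [BorelSpace.measurable_eq (α := ℝ), Real.borel_eq_generateFrom_Ioi_rat]
  refine @measurable_generateFrom _ _ (_) _ _ ?_
  rintro t ht
  obtain ⟨q, hq⟩ := Set.mem_iUnion.1 ht
  obtain rfl : t = Set.Ioi (q : ℝ) := hq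
  have := comap_prodMap_le_cantorJoin g (Denumerable.eqv ℚ q) _ (h (Denumerable.eqv ℚ q))
  simpa using this

/-! ### An atomless countably generated factor -/

theorem exists_measure_fiber_pos {S : Type*} [MeasurableSpace S] {μ : Measure S}
    [IsFiniteMeasure μ] {g : S → ℕ → Bool} (hg : Measurable g)
    (h : (μ.prod μ) {p : S × S | g p.1 = g p.2} ≠ 0) : ∃ c, μ (g ⁻¹' {c}) ≠ 0 := by
  contrapose! h
  have hm : MeasurableSet {p : S × S | g p.1 = g p.2} :=
    measurableSet_eq_fun (hg.comp measurable_fst) (hg.comp measurable_snd)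
  rw [Measure.prod_apply hm]
  refine lintegral_eq_zero_of_ae_eq_zero (ae_of_all _ fun x => ?_)
  refine Eq.trans (congrArg μ ?_) (h (g x))
  ext y
  simp [eq_comm]

/-- On an atomless space some measurable map to the Cantor space has only null fibres. It is found
by minimising the collision probability `(μ ⊗ μ) {(x, y) | g x = g y}`: the infimum is attained by
the join of a minimising sequence, and at a minimiser with positive value some fibre has positive
measure, so that splitting this fibre lowers the value. -/
theorem IsAtomless.exists_measurable_null_fibers {S : Type*} [MeasurableSpace S] {μ : Measure S}
    [IsFiniteMeasure μ] (hμ : IsAtomless μ) :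
    ∃ g : S → ℕ → Bool, Measurable g ∧ ∀ c, μ (g ⁻¹' {c}) = 0 := by
  classical
  let e : (S → ℕ → Bool) → ENNReal := fun g => (μ.prod μ) {p : S × S | g p.1 = g p.2}
  let T : Set ENNReal := e '' {g | Measurable g}
  have hT : T.Nonempty := ⟨_, fun _ _ => true, measurable_const, rfl⟩
  obtain ⟨u, -, hu, huT⟩ := exists_seq_tendsto_sInf hT ⟨0, fun _ _ => zero_le⟩
  choose g hg hgu using huT
  have hG : Measurable (cantorJoin g) := measurable_cantorJoin hg
  have hmin : e (cantorJoin g) ≤ sInf T := by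
    refine ge_of_tendsto' hu fun n => ?_
    rw [← hgu n]
    refine measure_mono fun p hp => ?_
    obtain ⟨q, -, hq⟩ := exists_measurable_eq_comp_cantorJoin g n
    simp only [Set.mem_ofPred_eq] at hp ⊢
    rw [hq, Function.comp_apply, Function.comp_apply, hp]
  refine ⟨cantorJoin g, hG, ?_⟩
  by_contra! hc
  obtain ⟨c, hc⟩ := hc
  set A := cantorJoin g ⁻¹' {c}
  obtain ⟨B, hBA, hB, hB0, hBlt⟩ := hμ A (hG (measurableSet_singleton c)) (pos_iff_ne_zero.2 hc)
  -- joining the indicator of `B` separates `B` from `A \ B` and so lowers `e` below its infimum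
  let b : S → ℕ → Bool := fun x _ => decide (x ∈ B)
  let k : ℕ → S → ℕ → Bool := fun n => if n = 0 then cantorJoin g else b
  have hb : Measurable b :=
    measurable_pi_lambda _ fun n => measurable_to_bool (by simpa [Set.preimage, b] using hB)
  have hk : ∀ n, Measurable (k n) := fun n => by by_cases hn : n = 0 <;> simp [k, hn, hG, hb]
  have hle : sInf T ≤ e (cantorJoin k) :=
    sInf_le ⟨_, measurable_cantorJoin hk, rfl⟩
  have hAB : MeasurableSet (A \ B) := (hG (measurableSet_singleton c)).diff hB
  have hsub : {p : S × S | cantorJoin k p.1 = cantorJoin k p.2} ∪ B ×ˢ (A \ B) ⊆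
      {p : S × S | cantorJoin g p.1 = cantorJoin g p.2} := by
    rintro ⟨x, y⟩ (h | h)
    · obtain ⟨q, -, hq⟩ := exists_measurable_eq_comp_cantorJoin k 0
      have hq' : cantorJoin g = q ∘ cantorJoin k := hq
      simp only [Set.mem_ofPred_eq] at h ⊢
      rw [hq', Function.comp_apply, Function.comp_apply, h]
    · have h1 : cantorJoin g x = c := hBA h.1
      have h2 : cantorJoin g y = c := h.2.1
      simp [h1, h2]
  have hdisj : Disjoint {p : S × S | cantorJoin k p.1 = cantorJoin k p.2} (B ×ˢ (A \ B)) := by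
    rw [Set.disjoint_left]
    rintro ⟨x, y⟩ h ⟨hx, hy⟩
    obtain ⟨q, -, hq⟩ := exists_measurable_eq_comp_cantorJoin k 1
    have hq' : b = q ∘ cantorJoin k := hq
    simp only [Set.mem_ofPred_eq] at h
    have : b x 0 = b y 0 := by rw [hq', Function.comp_apply, Function.comp_apply, h]
    simp only [b, decide_eq_decide] at this
    exact hy.2 (this.1 hx)
  have hlt : e (cantorJoin k) + μ B * μ (A \ B) ≤ e (cantorJoin k) := by
    calc e (cantorJoin k) + μ B * μ (A \ B)
        = (μ.prod μ) ({p : S × S | cantorJoin k p.1 = cantorJoin k p.2} ∪ B ×ˢ (A \ B)) := by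
          rw [measure_union hdisj (hB.prod hAB), Measure.prod_prod]
      _ ≤ e (cantorJoin g) := measure_mono hsub
      _ ≤ e (cantorJoin k) := hmin.trans hle
  have h0 : μ B * μ (A \ B) ≠ 0 := by
    refine mul_ne_zero hB0.ne' ?_
    rw [measure_sdiff hBA hB.nullMeasurableSet (measure_ne_top μ B)]
    exact (tsub_pos_of_lt hBlt).ne'
  exact hlt.not_gt (ENNReal.lt_add_right (measure_ne_top _ _) h0)

/-- A measurable function on `S × S` factors through `g × g` for a Cantor-space-valued `g` which, on an
atomless space, can be taken with null fibres. -/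
theorem IsAtomless.exists_factor {S : Type*} [MeasurableSpace S] {μ : Measure S}
    [IsFiniteMeasure μ] (hμ : IsAtomless μ) {F : S × S → ℝ} (hF : Measurable F) :
    ∃ (g : S → ℕ → Bool) (V : (ℕ → Bool) × (ℕ → Bool) → ℝ), Measurable g ∧ Measurable V ∧
      (∀ c, μ (g ⁻¹' {c}) = 0) ∧ F = V ∘ Prod.map g g := by
  obtain ⟨g₁, hg₁, h₁⟩ := hF.exists_measurable_comap_prodMap
  obtain ⟨g₂, hg₂, h₂⟩ := hμ.exists_measurable_null_fibers
  let k : ℕ → S → ℕ → Bool := fun n => if n = 0 then g₁ else g₂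
  have hk : ∀ n, Measurable (k n) := fun n => by by_cases hn : n = 0 <;> simp [k, hn, hg₁, hg₂]
  have hF' : Measurable[MeasurableSpace.comap (Prod.map (cantorJoin k) (cantorJoin k))
      inferInstance] F := h₁.mono (comap_prodMap_le_cantorJoin k 0) le_rfl
  obtain ⟨V, hV, hFV⟩ := hF'.exists_eq_measurable_comp
  refine ⟨cantorJoin k, V, measurable_cantorJoin hk, hV, fun c => ?_, hFV⟩
  obtain ⟨q, -, hq⟩ := exists_measurable_eq_comp_cantorJoin k 1
  have hq' : g₂ = q ∘ cantorJoin k := hq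
  refine measure_mono_null ?_ (h₂ (q c))
  rintro x hx
  have : cantorJoin k x = c := hx
  simp [hq', this]

/-! ### Real-valued codes of the Cantor space -/

theorem measurable_cantorFunction_third : Measurable (Cardinal.cantorFunction (1 / 3)) := by
  refine measurable_of_tendsto_metrizable
    (f := fun N f => ∑ n ∈ Finset.range N, Cardinal.cantorFunctionAux (1 / 3) f n)
    (fun N => Finset.measurable_sum _ fun n _ => ?_) ?_
  · exact (measurable_of_finite fun b : Bool => cond b ((1 / 3 : ℝ) ^ n) 0).comp
      (measurable_pi_apply n)
  · rw [tendsto_pi_nhds]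
    exact fun f => (Cardinal.summable_cantor_function f (by norm_num) (by norm_num)).hasSum
      |>.tendsto_sum_nat

theorem cantorFunction_third_injective : Function.Injective (Cardinal.cantorFunction (1 / 3)) :=
  Cardinal.cantorFunction_injective (by norm_num) (by norm_num)

theorem cantorFunction_third_mem_Icc (f : ℕ → Bool) :
    Cardinal.cantorFunction (1 / 3) f ∈ Set.Icc (0 : ℝ) 2 := by
  refine ⟨tsum_nonneg fun n => Cardinal.cantorFunctionAux_nonneg (by norm_num), ?_⟩
  refine (Cardinal.cantorFunction_le (g := fun _ => true) (by norm_num) (by norm_num)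
    fun _ _ => rfl).trans ?_
  have : Cardinal.cantorFunction (1 / 3) (fun _ => true) = ∑' n : ℕ, (1 / 3 : ℝ) ^ n := rfl
  rw [this, tsum_geometric_of_lt_one (by norm_num) (by norm_num)]
  norm_num

/-! ### A monotone function capturing all antitone functions -/

/-- The order enters only through the functions antitone for it. As `L¹` is separable, countably
many of them, `uₙ`, are dense among those factoring through `g`; the superlevel sets
`{q < uₙ ∘ g}`, `q ∈ ℚ`, are then down-sets, and `Φ` records in its ternary digits the
complementary up-sets containing a given point. So `Φ` is monotone, its digits determine all `uₙ`,
and an `L¹`-limit of the `uₙ` is almost everywhere a function of `Φ` too. -/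
theorem exists_monotone_capturing_antitone {S Ω : Type*} [MeasurableSpace S] [MeasurableSpace Ω]
    [MeasurableSpace.CountablyGenerated Ω] (μ : Measure S) [IsFiniteMeasure μ] (r : S → S → Prop)
    {g : S → Ω} (hg : Measurable g) :
    ∃ Φ : S → ℝ, Measurable Φ ∧ (∀ x, Φ x ∈ Set.Icc (0 : ℝ) 2) ∧ (∀ x y, r x y → Φ x ≤ Φ y) ∧
      ∀ u : Ω → ℝ, Measurable u → (∃ C, ∀ c, |u c| ≤ C) → (∀ x y, r x y → u (g y) ≤ u (g x)) →
        ∃ w : ℝ → ℝ, Measurable w ∧ (fun x => u (g x)) =ᵐ[μ] fun x => w (Φ x) := by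
  classical
  let ν := μ.map g
  have : IsFiniteMeasure ν := inferInstance
  let P : (Ω → ℝ) → Prop := fun u => Measurable u ∧ ∀ x y, r x y → u (g y) ≤ u (g x)
  let T : Set (Lp ℝ 1 ν) := {F | ∃ u, P u ∧ F =ᵐ[ν] u}
  have : Fact ((1 : ENNReal) ≤ 1) := ⟨le_rfl⟩
  have : Fact ((1 : ENNReal) ≠ ⊤) := ⟨ENNReal.one_ne_top⟩
  obtain ⟨t, htT, htc, hTt⟩ :=
    (TopologicalSpace.IsSeparable.of_separableSpace T).exists_countable_dense_subset
  have hT0 : (0 : Lp ℝ 1 ν) ∈ T :=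
    ⟨fun _ => 0, ⟨measurable_const, fun _ _ _ => le_rfl⟩, Lp.coeFn_zero ℝ 1 ν⟩
  have htne : t.Nonempty := closure_nonempty_iff.1 ⟨0, hTt hT0⟩
  obtain ⟨F, hF⟩ := htc.exists_eq_range htne
  have hFT : ∀ n, F n ∈ T := fun n => htT (hF ▸ Set.mem_range_self n)
  choose u hu hFu using hFT
  let e : ℕ ≃ ℕ × ℚ := (Denumerable.eqv (ℕ × ℚ)).symm
  let bits : S → ℕ → Bool := fun x k => decide (u (e k).1 (g x) ≤ ((e k).2 : ℝ))
  have hbits : Measurable bits := by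
    refine measurable_pi_lambda _ fun k => measurable_to_bool ?_
    have := measurableSet_le ((hu (e k).1).1.comp hg)
      (measurable_const (a := (((e k).2 : ℚ) : ℝ)))
    simpa [Set.preimage, bits] using this
  let Φ : S → ℝ := fun x => Cardinal.cantorFunction (1 / 3) (bits x)
  have hΦ : Measurable Φ := measurable_cantorFunction_third.comp hbits
  have hemb : MeasurableEmbedding (Cardinal.cantorFunction (1 / 3)) :=
    measurable_cantorFunction_third.measurableEmbedding cantorFunction_third_injective
  let m : MeasurableSpace S := MeasurableSpace.comap Φ inferInstance
  -- the ternary code is a measurable embedding, so `Φ` generates the same `σ`-algebra as its digits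
  have hbm : Measurable[m] bits := by
    rw [show m = MeasurableSpace.comap bits inferInstance by
      rw [← hemb.comap_eq, MeasurableSpace.comap_comp]; rfl]
    exact comap_measurable bits
  have hum : ∀ n, Measurable[m] fun x => u n (g x) := by
    intro n
    rw [BorelSpace.measurable_eq (α := ℝ), Real.borel_eq_generateFrom_Ioi_rat]
    refine @measurable_generateFrom _ _ (_) _ _ ?_
    rintro s hs
    obtain ⟨q, hq⟩ := Set.mem_iUnion.1 hs
    obtain rfl : s = Set.Ioi (q : ℝ) := hq
    have h1 : MeasurableSet[m] ((fun x => bits x (e.symm (n, q))) ⁻¹' {false}) :=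
      ((measurable_pi_apply (e.symm (n, q))).comp hbm) (measurableSet_singleton false)
    convert h1 using 1
    ext x
    simp [bits]
  refine ⟨Φ, hΦ, fun x => cantorFunction_third_mem_Icc _, fun x y hxy => ?_, ?_⟩
  · refine Cardinal.cantorFunction_le (by norm_num) (by norm_num) fun k hk => ?_
    simp only [bits, decide_eq_true_eq] at hk ⊢
    exact ((hu _).2 x y hxy).trans hk
  rintro v hv ⟨C, hC⟩ hanti
  have hvL : MemLp v 1 ν :=
    MemLp.of_bound hv.aestronglyMeasurable C (ae_of_all _ fun c => by simpa using hC c)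
  have hvT : hvL.toLp v ∈ closure (Set.range F) :=
    hF ▸ hTt ⟨v, ⟨hv, hanti⟩, hvL.coeFn_toLp⟩
  obtain ⟨y, hyr, hy⟩ := mem_closure_iff_seq_limit.1 hvT
  choose n hn using hyr
  obtain ⟨ns, -, hns⟩ := (tendstoInMeasure_of_tendsto_Lp hy).exists_seq_tendsto_ae
  have hlim : ∀ᵐ c ∂ν, Filter.Tendsto (fun k => u (n (ns k)) c) Filter.atTop (nhds (v c)) := by
    filter_upwards [hns, hvL.coeFn_toLp, ae_all_iff.2 fun k => hFu (n (ns k))] with c h1 h2 h3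
    rw [h2] at h1
    refine h1.congr fun k => ?_
    rw [← hn (ns k), h3 k]
  have hlim' := ae_of_ae_map hg.aemeasurable hlim
  have hW : Measurable[m] fun x => Filter.limsup (fun k => u (n (ns k)) (g x)) Filter.atTop :=
    Measurable.limsup fun k => hum _
  obtain ⟨w, hw, hwe⟩ := hW.exists_eq_measurable_comp
  refine ⟨w, hw, ?_⟩
  filter_upwards [hlim'] with x hx
  have := congrFun hwe x
  simp only [Function.comp_apply] at this
  rw [← this, hx.limsup_eq]

/-! ### Monotone rearrangement to the uniform distribution -/

/-- The probability integral transform: the distribution function of an atomless law pushes the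
law to the uniform distribution. -/
theorem measurePreserving_cdf (ν : Measure ℝ) [IsProbabilityMeasure ν]
    (hν : ∀ t, ν {t} = 0) :
    MeasurePreserving
      (fun t => (⟨ProbabilityTheory.cdf ν t, ProbabilityTheory.cdf_nonneg ν t,
        ProbabilityTheory.cdf_le_one ν t⟩ : unitInterval)) ν volume := by
  set F : ℝ → unitInterval := fun t => (⟨ProbabilityTheory.cdf ν t,
    ProbabilityTheory.cdf_nonneg ν t, ProbabilityTheory.cdf_le_one ν t⟩ : unitInterval)
  have hF : Monotone F := fun a b hab => ProbabilityTheory.monotone_cdf ν hab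
  have hFm : Measurable F := hF.measurable
  have : IsProbabilityMeasure (ν.map F) := Measure.isProbabilityMeasure_map hFm.aemeasurable
  have hcont : Continuous (ProbabilityTheory.cdf ν) := by
    rw [continuous_iff_continuousAt]
    intro t
    rw [(ProbabilityTheory.monotone_cdf ν).continuousAt_iff_leftLim_eq_rightLim]
    have h1 := (ProbabilityTheory.cdf ν).measure_singleton t
    rw [ProbabilityTheory.measure_cdf, hν t] at h1
    have h2 := ENNReal.ofReal_eq_zero.1 h1.symm
    have h3 := (ProbabilityTheory.monotone_cdf ν).leftLim_le (le_refl t)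
    rw [StieltjesFunction.rightLim_eq]
    linarith
  refine ⟨hFm, Measure.ext_of_Iic _ _ fun c => ?_⟩
  rw [Measure.map_apply hFm measurableSet_Iic, unitInterval.volume_Iic]
  rcases eq_or_lt_of_le c.2.2 with hc1 | hc1
  · have : F ⁻¹' Set.Iic c = Set.univ := by
      ext t
      simp only [Set.mem_preimage, Set.mem_Iic, Set.mem_univ, iff_true]
      exact Subtype.coe_le_coe.1 (hc1 ▸ (F t).2.2)
    rw [this, measure_univ, hc1, ENNReal.ofReal_one]
  -- below `c < 1` the preimage is bounded above, and if nonempty it is a closed half-line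
  obtain ⟨b, hb⟩ := ((ProbabilityTheory.tendsto_cdf_atTop ν).eventually (lt_mem_nhds hc1)).exists
  have hpre : F ⁻¹' Set.Iic c = {t | ProbabilityTheory.cdf ν t ≤ c} := rfl
  rw [hpre]
  rcases Set.eq_empty_or_nonempty {t | ProbabilityTheory.cdf ν t ≤ c} with he | hne
  · rw [he, measure_empty, eq_comm, ENNReal.ofReal_eq_zero]
    refine ge_of_tendsto' (ProbabilityTheory.tendsto_cdf_atBot ν) fun t => ?_
    by_contra! h
    exact (Set.eq_empty_iff_forall_notMem.1 he t) h.le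
  · have hbd : BddAbove {t | ProbabilityTheory.cdf ν t ≤ c} := by
      refine ⟨b, fun t ht => ?_⟩
      by_contra! hbt
      exact (hb.trans_le (ProbabilityTheory.monotone_cdf ν hbt.le)).not_ge ht
    have hcl : IsClosed {t | ProbabilityTheory.cdf ν t ≤ c} :=
      isClosed_le hcont continuous_const
    set s := sSup {t | ProbabilityTheory.cdf ν t ≤ c}
    have hsm : ProbabilityTheory.cdf ν s ≤ c := hcl.csSup_mem hne hbd
    have hIic : {t | ProbabilityTheory.cdf ν t ≤ c} = Set.Iic s := by
      ext t
      exact ⟨fun ht => le_csSup hbd ht,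
        fun ht => (ProbabilityTheory.monotone_cdf ν ht).trans hsm⟩
    have hsb : s ≤ b := by
      by_contra! h
      exact (hb.trans_le (ProbabilityTheory.monotone_cdf ν h.le)).not_ge hsm
    obtain ⟨t, ht, htc⟩ := intermediate_value_Icc hsb hcont.continuousOn ⟨hsm, hb.le⟩
    have hts : t ≤ s := le_csSup hbd htc.le
    obtain rfl : t = s := le_antisymm hts ht.1
    rw [hIic, ← ProbabilityTheory.ofReal_cdf, htc]

/-- A function with atomless law has almost no essential maximum points on a set `A`: of two
independent such points, the one with the smaller value would have to lie in a null set. -/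
theorem measure_essentially_maximal_eq_zero {S : Type*} [MeasurableSpace S] {μ : Measure S}
    [IsFiniteMeasure μ] {Ψ : S → ℝ} (hΨ : Measurable Ψ) (hΨ0 : ∀ t, μ (Ψ ⁻¹' {t}) = 0)
    {A : Set S} (hA : MeasurableSet A) : μ {x ∈ A | μ (A ∩ {w | Ψ x < Ψ w}) = 0} = 0 := by
  have hL : MeasurableSet {p : S × S | p.2 ∈ A ∧ Ψ p.1 < Ψ p.2} :=
    (measurable_snd hA).inter
      (measurableSet_lt (hΨ.comp measurable_fst) (hΨ.comp measurable_snd))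
  have hlt : MeasurableSet {p : S × S | Ψ p.1 < Ψ p.2} :=
    measurableSet_lt (hΨ.comp measurable_fst) (hΨ.comp measurable_snd)
  have heq : MeasurableSet {p : S × S | Ψ p.1 = Ψ p.2} :=
    measurableSet_eq_fun (hΨ.comp measurable_fst) (hΨ.comp measurable_snd)
  set E := {x ∈ A | μ (A ∩ {w | Ψ x < Ψ w}) = 0}
  have hE : MeasurableSet E :=
    hA.inter (measurable_measure_prodMk_left (ν := μ) hL (measurableSet_singleton 0))
  -- the pairs in `E × E` are null, whichever way `Ψ` compares their entries
  have h1 : (μ.prod μ) (E ×ˢ E ∩ {p | Ψ p.1 < Ψ p.2}) = 0 := by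
    rw [Measure.prod_apply ((hE.prod hE).inter hlt)]
    refine lintegral_eq_zero_of_ae_eq_zero (ae_of_all _ fun x => ?_)
    by_cases hx : x ∈ E
    · exact measure_mono_null (t := A ∩ {w | Ψ x < Ψ w}) (fun w hw => ⟨hw.1.2.1, hw.2⟩) hx.2
    · refine measure_mono_null (fun w hw => ?_) measure_empty
      exact hx hw.1.1
  have h2 : (μ.prod μ) (E ×ˢ E ∩ {p | Ψ p.2 < Ψ p.1}) = 0 := by
    have := (Measure.measurePreserving_swap (μ := μ) (ν := μ)).measure_preimage
      ((hE.prod hE).inter hlt).nullMeasurableSet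
    rw [h1] at this
    refine measure_mono_null (fun p hp => ?_) this
    exact ⟨⟨hp.1.2, hp.1.1⟩, hp.2⟩
  have h3 : (μ.prod μ) {p | Ψ p.1 = Ψ p.2} = 0 := by
    rw [Measure.prod_apply heq]
    refine lintegral_eq_zero_of_ae_eq_zero (ae_of_all _ fun x => ?_)
    exact measure_mono_null (fun w hw => Eq.symm hw) (hΨ0 (Ψ x))
  have h4 : (μ.prod μ) (E ×ˢ E) = 0 := by
    refine measure_mono_null (fun p hp => ?_) (measure_union_null (measure_union_null h1 h2) h3)
    rcases lt_trichotomy (Ψ p.1) (Ψ p.2) with h | h | h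
    · exact Or.inl (Or.inl ⟨hp, h⟩)
    · exact Or.inr h
    · exact Or.inl (Or.inr ⟨hp, h⟩)
  rw [Measure.prod_prod] at h4
  exact mul_self_eq_zero.1 h4

/-- A real function `Φ` can be refined to a function `Ψ` with atomless law: each atom of the law
of `Φ` is spread out over an interval by means of `h`. -/
theorem exists_atomless_refinement {S : Type*} [MeasurableSpace S] (μ : Measure S)
    [IsFiniteMeasure μ] {Φ h : S → ℝ} (hΦ : Measurable Φ) (hh : Measurable h)
    (hh1 : ∀ x, h x ∈ Set.Icc (0 : ℝ) 1) (hh0 : ∀ t, μ (h ⁻¹' {t}) = 0) :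
    ∃ Ψ : S → ℝ, Measurable Ψ ∧ (∀ x y, Φ x < Φ y → Ψ x < Ψ y) ∧ ∀ t, μ (Ψ ⁻¹' {t}) = 0 := by
  let L : ℝ → ℝ := fun t => μ.real {z | Φ z < t}
  let R : ℝ → ℝ := fun t => μ.real {z | Φ z ≤ t}
  have hL : Monotone L := fun a b hab =>
    measureReal_mono fun z (hz : Φ z < a) => lt_of_lt_of_le hz hab
  have hR : Monotone R := fun a b hab =>
    measureReal_mono fun z (hz : Φ z ≤ a) => le_trans hz hab
  have hLR : ∀ t, L t ≤ R t := fun t => measureReal_mono fun z (hz : Φ z < t) => le_of_lt hz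
  have hRL : ∀ s t, s < t → R s ≤ L t := fun s t hst =>
    measureReal_mono fun z (hz : Φ z ≤ s) => lt_of_le_of_lt hz hst
  have hatom : ∀ t, R t = L t → μ (Φ ⁻¹' {t}) = 0 := by
    intro t ht
    have hd : {z | Φ z ≤ t} = {z | Φ z < t} ∪ Φ ⁻¹' {t} := by
      ext z; simp [le_iff_lt_or_eq]
    have hdisj : Disjoint {z | Φ z < t} (Φ ⁻¹' {t}) := by
      rw [Set.disjoint_left]
      intro z hz hz'
      exact (ne_of_lt hz) hz'
    have h1 : R t = L t + μ.real (Φ ⁻¹' {t}) := by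
      change μ.real _ = μ.real _ + _
      rw [hd, measureReal_union hdisj (hΦ (measurableSet_singleton t))]
    have h2 : μ.real (Φ ⁻¹' {t}) = 0 := by linarith
    exact (measureReal_eq_zero_iff).1 h2
  let Ψ : S → ℝ := fun x => Φ x + L (Φ x) + (R (Φ x) - L (Φ x)) * h x
  have hmono : ∀ x y, Φ x < Φ y → Ψ x < Ψ y := by
    intro x y hxy
    have h1 : (R (Φ x) - L (Φ x)) * h x ≤ (R (Φ x) - L (Φ x)) * 1 :=
      mul_le_mul_of_nonneg_left (hh1 x).2 (sub_nonneg.2 (hLR _))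
    have h2 : 0 ≤ (R (Φ y) - L (Φ y)) * h y :=
      mul_nonneg (sub_nonneg.2 (hLR _)) (hh1 y).1
    have h3 := hRL _ _ hxy
    change Φ x + L (Φ x) + (R (Φ x) - L (Φ x)) * h x < Φ y + L (Φ y) + (R (Φ y) - L (Φ y)) * h y
    linarith
  refine ⟨Ψ, (hΦ.add (hL.measurable.comp hΦ)).add
    (((hR.measurable.comp hΦ).sub (hL.measurable.comp hΦ)).mul hh), hmono, fun t => ?_⟩
  rcases Set.eq_empty_or_nonempty (Ψ ⁻¹' {t}) with he | ⟨x₀, hx₀⟩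
  · rw [he, measure_empty]
  have hlevel : ∀ x ∈ Ψ ⁻¹' {t}, Φ x = Φ x₀ := by
    intro x hx
    have hxx : Ψ x = Ψ x₀ := Eq.trans hx (Eq.symm hx₀)
    rcases lt_trichotomy (Φ x) (Φ x₀) with hlt | heq | hgt
    · exact absurd hxx (hmono _ _ hlt).ne
    · exact heq
    · exact absurd hxx (hmono _ _ hgt).ne'
  by_cases hRL0 : R (Φ x₀) = L (Φ x₀)
  · exact measure_mono_null hlevel (hatom _ hRL0)
  · refine measure_mono_null (fun x hx => ?_) (hh0 (h x₀))
    have hxx : Ψ x = Ψ x₀ := Eq.trans hx (Eq.symm hx₀)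
    simp only [Ψ, hlevel x hx] at hxx
    exact mul_left_cancel₀ (sub_ne_zero.2 hRL0) (by linarith)

/-- A bounded function `Φ` on a space carrying a function `h` with atomless law is, up to a null
set, a function of some uniformly distributed `f` which is monotone along `Φ`. -/
theorem exists_measurePreserving_unitInterval {S : Type*} [MeasurableSpace S] (μ : Measure S)
    [IsProbabilityMeasure μ] {Φ h : S → ℝ} (hΦ : Measurable Φ)
    (hΦ1 : ∀ x, Φ x ∈ Set.Icc (0 : ℝ) 2) (hh : Measurable h)
    (hh1 : ∀ x, h x ∈ Set.Icc (0 : ℝ) 1) (hh0 : ∀ t, μ (h ⁻¹' {t}) = 0) :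
    ∃ (f : S → unitInterval) (k : unitInterval → ℝ), MeasurePreserving f μ volume ∧
      (∀ x y, Φ x < Φ y → f x ≤ f y) ∧ Measurable k ∧ Φ =ᵐ[μ] fun x => k (f x) := by
  obtain ⟨Ψ, hΨ, hmono, hΨ0⟩ := exists_atomless_refinement μ hΦ hh hh1 hh0
  let ν := μ.map Ψ
  have : IsProbabilityMeasure ν := Measure.isProbabilityMeasure_map hΨ.aemeasurable
  have hν0 : ∀ t, ν {t} = 0 := fun t => by
    rw [Measure.map_apply hΨ (measurableSet_singleton t)]; exact hΨ0 t
  let F : ℝ → unitInterval := fun t => (⟨ProbabilityTheory.cdf ν t,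
    ProbabilityTheory.cdf_nonneg ν t, ProbabilityTheory.cdf_le_one ν t⟩ : unitInterval)
  have hF : Monotone F := fun a b hab => ProbabilityTheory.monotone_cdf ν hab
  let f : S → unitInterval := fun x => F (Ψ x)
  -- the least nonnegative monotone function with `Φ ≤ k ∘ f`
  let k : unitInterval → ℝ := fun u => sSup {t | ∃ z, f z ≤ u ∧ Φ z = t}
  have hbd : ∀ u, BddAbove {t | ∃ z, f z ≤ u ∧ Φ z = t} := by
    rintro u
    refine ⟨2, ?_⟩
    rintro _ ⟨z, -, rfl⟩
    exact (hΦ1 z).2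
  have hk : Monotone k := by
    intro u v huv
    refine Real.sSup_le ?_ (Real.sSup_nonneg ?_)
    · rintro _ ⟨z, hz, rfl⟩
      exact le_csSup (hbd v) ⟨z, hz.trans huv, rfl⟩
    · rintro _ ⟨z, -, rfl⟩
      exact (hΦ1 z).1
  refine ⟨f, k, (measurePreserving_cdf ν hν0).comp ⟨hΨ, rfl⟩,
    fun x y hxy => hF (hmono x y hxy).le, hk.measurable, ?_⟩
  have hE : ∀ q : ℚ, ∀ᵐ x ∂μ,
      ¬ (Φ x < q ∧ μ ({w | Φ w < q} ∩ {w | Ψ x < Ψ w}) = 0) := by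
    intro q
    have := measure_essentially_maximal_eq_zero hΨ hΨ0
      (measurableSet_lt hΦ (measurable_const (a := (q : ℝ))))
    rw [ae_iff]
    simpa using this
  filter_upwards [ae_all_iff.2 hE] with x hx
  refine le_antisymm (le_csSup (hbd _) ⟨x, le_rfl, rfl⟩) (csSup_le ⟨_, x, le_rfl, rfl⟩ ?_)
  rintro _ ⟨z, hz, rfl⟩
  -- otherwise `f x = f z`, so that no mass lies in `(Ψ x, Ψ z]`, although `Φ x < q < Φ z`
  by_contra! hlt
  obtain ⟨q, hq1, hq2⟩ := exists_rat_btwn hlt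
  refine hx q ⟨hq1, ?_⟩
  have hΨlt := hmono _ _ hlt
  have hfe : ProbabilityTheory.cdf ν (Ψ x) = ProbabilityTheory.cdf ν (Ψ z) :=
    congrArg Subtype.val (le_antisymm (hF hΨlt.le) hz)
  have hIoc : ν (Set.Ioc (Ψ x) (Ψ z)) = 0 := by
    rw [← ProbabilityTheory.measure_cdf ν, StieltjesFunction.measure_Ioc, hfe, sub_self,
      ENNReal.ofReal_zero]
  rw [Measure.map_apply hΨ measurableSet_Ioc] at hIoc
  refine measure_mono_null ?_ hIoc
  rintro w ⟨hw1, hw2⟩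
  exact ⟨hw2, (hmono _ _ (lt_trans hw1 hq2)).le⟩

/-! ### From sections to functions of two variables -/

/-- A bounded function of `g` which is almost everywhere a function of `f` is recovered by
averaging over the conditional distribution of `g` given `f`. -/
theorem ae_eq_integral_condDistrib {S T Ω : Type*} [MeasurableSpace S] [MeasurableSpace T]
    [MeasurableSpace Ω] [StandardBorelSpace Ω] [Nonempty Ω] {μ : Measure S} [IsFiniteMeasure μ]
    {f : S → T} {g : S → Ω} (hf : Measurable f) (hg : Measurable g) {v : Ω → ℝ}
    (hv : Measurable v) {C : ℝ} (hC : ∀ c, |v c| ≤ C)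
    (hw : ∃ w : T → ℝ, Measurable w ∧ (fun x => v (g x)) =ᵐ[μ] fun x => w (f x)) :
    ∀ᵐ x ∂μ, v (g x) = ∫ c, v c ∂(ProbabilityTheory.condDistrib g f μ (f x)) := by
  obtain ⟨w, hwm, hwe⟩ := hw
  have hint : Integrable (fun x => v (g x)) μ :=
    Integrable.of_bound (hv.comp hg).aestronglyMeasurable C (ae_of_all _ fun x => by
      simpa using hC (g x))
  have h1 := ProbabilityTheory.condExp_ae_eq_integral_condDistrib (μ := μ) hf hg.aemeasurable
    hv.stronglyMeasurable hint
  have h2 : μ[fun x => v (g x) | MeasurableSpace.comap f inferInstance] =ᵐ[μ]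
      fun x => v (g x) := by
    refine condExp_of_aestronglyMeasurable' hf.comap_le ⟨fun x => w (f x), ?_, hwe⟩ hint
    exact (hwm.comp (comap_measurable f)).stronglyMeasurable
  exact h2.symm.trans h1

/-- A bounded function of two variables, all of whose sections in either variable are almost
everywhere functions of `f`, is almost everywhere a function of `f × f`: one averages over the
conditional distribution of `g` given `f` in each variable in turn. -/
theorem exists_measurable_of_sections {S T Ω : Type*} [MeasurableSpace S] [MeasurableSpace T]
    [MeasurableSpace Ω] [StandardBorelSpace Ω] [Nonempty Ω] {μ : Measure S} [IsFiniteMeasure μ]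
    {f : S → T} {g : S → Ω} (hf : Measurable f) (hg : Measurable g) {V : Ω × Ω → ℝ}
    (hV : Measurable V) {C : ℝ} (hC : ∀ c, |V c| ≤ C)
    (h1 : ∀ y, ∃ w : T → ℝ, Measurable w ∧ (fun x => V (g x, g y)) =ᵐ[μ] fun x => w (f x))
    (h2 : ∀ x, ∃ w : T → ℝ, Measurable w ∧ (fun y => V (g x, g y)) =ᵐ[μ] fun y => w (f y)) :
    ∃ U : T × T → ℝ, Measurable U ∧ ∀ᵐ p ∂(μ.prod μ), V (g p.1, g p.2) = U (f p.1, f p.2) := by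
  let κ := ProbabilityTheory.condDistrib g f μ
  let V₁ : T × Ω → ℝ := fun p => ∫ c, V (c, p.2) ∂(κ p.1)
  have hV₁ : Measurable V₁ := by
    have hm : StronglyMeasurable fun q : (T × Ω) × Ω => V (q.2, q.1.2) :=
      (hV.comp (measurable_snd.prodMk (measurable_snd.comp measurable_fst))).stronglyMeasurable
    exact (hm.integral_kernel_prod_right'
      (κ := κ.comap Prod.fst measurable_fst)).measurable
  let U : T × T → ℝ := fun p => ∫ d, V₁ (p.1, d) ∂(κ p.2)
  have hU : Measurable U := by
    have hm : StronglyMeasurable fun q : (T × T) × Ω => V₁ (q.1.1, q.2) :=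
      (hV₁.comp ((measurable_fst.comp measurable_fst).prodMk measurable_snd)).stronglyMeasurable
    exact (hm.integral_kernel_prod_right' (κ := κ.comap Prod.snd measurable_snd)).measurable
  have hV₁C : ∀ p, |V₁ p| ≤ C := fun p => by
    have := norm_integral_le_of_norm_le_const (μ := κ p.1) (f := fun c => V (c, p.2))
      (ae_of_all _ fun c => (Real.norm_eq_abs _).trans_le (hC (c, p.2)))
    simpa using this
  have hmV : Measurable fun p : S × S => V (g p.1, g p.2) :=
    hV.comp ((hg.comp measurable_fst).prodMk (hg.comp measurable_snd))
  have hmV₁ : Measurable fun p : S × S => V₁ (f p.1, g p.2) :=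
    hV₁.comp ((hf.comp measurable_fst).prodMk (hg.comp measurable_snd))
  have hmU : Measurable fun p : S × S => U (f p.1, f p.2) :=
    hU.comp ((hf.comp measurable_fst).prodMk (hf.comp measurable_snd))
  have step1 : ∀ᵐ p ∂(μ.prod μ), V (g p.1, g p.2) = V₁ (f p.1, g p.2) := by
    have hs : ∀ᵐ p ∂(μ.prod μ), V (g p.2, g p.1) = V₁ (f p.2, g p.1) := by
      refine (Measure.ae_prod_iff_ae_ae (measurableSet_eq_fun (hmV.comp measurable_swap)
        (hmV₁.comp measurable_swap))).2 (ae_of_all _ fun y => ?_)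
      exact ae_eq_integral_condDistrib hf hg (v := fun c => V (c, g y))
        (hV.comp (measurable_id.prodMk measurable_const)) (fun c => hC _) (h1 y)
    exact (Measure.measurePreserving_swap (μ := μ) (ν := μ)).quasiMeasurePreserving.ae hs
  have step2 : ∀ᵐ p ∂(μ.prod μ), V₁ (f p.1, g p.2) = U (f p.1, f p.2) := by
    refine (Measure.ae_prod_iff_ae_ae (measurableSet_eq_fun hmV₁ hmU)).2 ?_
    filter_upwards [Measure.ae_ae_of_ae_prod step1] with x hx
    refine ae_eq_integral_condDistrib hf hg (v := fun d => V₁ (f x, d))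
      (hV₁.comp (measurable_const.prodMk measurable_id)) (fun c => hV₁C _) ?_
    obtain ⟨w, hw, hwe⟩ := h2 x
    refine ⟨w, hw, ?_⟩
    filter_upwards [hx, hwe] with y hy1 hy2
    rw [← hy1, hy2]
  exact ⟨U, hU, step1.mp (step2.mono fun p h h' => h'.trans h)⟩

/-! ### Density points -/

/-- The set `A` has Lebesgue density zero at `p`, that is, `p` is a density point of `Aᶜ`. The
density is taken along the closed balls of radius `1 / (n + 1)` (squares, as `ℝ × ℝ` carries the sup norm). -/
def HasDensityZeroAt (A : Set (ℝ × ℝ)) (p : ℝ × ℝ) : Prop :=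
  Filter.Tendsto (fun n : ℕ => volume (A ∩ Metric.closedBall p (1 / ((n : ℝ) + 1))) /
    volume (Metric.closedBall p (1 / ((n : ℝ) + 1)))) Filter.atTop (nhds 0)

theorem tendsto_one_div_add_one_nhdsGT :
    Filter.Tendsto (fun n : ℕ => 1 / ((n : ℝ) + 1)) Filter.atTop (nhdsWithin 0 (Set.Ioi 0)) :=
  tendsto_nhdsWithin_iff.2 ⟨tendsto_one_div_add_atTop_nhds_zero_nat,
    Filter.Eventually.of_forall fun n => Set.mem_Ioi.2 (by positivity)⟩

theorem ae_hasDensityZeroAt_iff {A : Set (ℝ × ℝ)} (hA : MeasurableSet A) :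
    ∀ᵐ p : ℝ × ℝ, HasDensityZeroAt A p ↔ p ∉ A := by
  filter_upwards [Besicovitch.ae_tendsto_measure_inter_div_of_measurableSet volume hA] with p hp
  have h := hp.comp tendsto_one_div_add_one_nhdsGT
  constructor
  · intro h0 hpA
    rw [Set.indicator_of_mem hpA] at h
    exact zero_ne_one (tendsto_nhds_unique h0 h)
  · intro hpA
    rw [Set.indicator_of_notMem hpA] at h
    exact h

theorem measurableSet_hasDensityZeroAt {A : Set (ℝ × ℝ)} (hA : MeasurableSet A) :
    MeasurableSet {p | HasDensityZeroAt A p} := by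
  refine measurableSet_tendsto _ fun n => Measurable.div ?_ ?_
  · have hm : MeasurableSet {q : (ℝ × ℝ) × (ℝ × ℝ) | q.2 ∈ A ∧
        q.2 ∈ Metric.closedBall q.1 (1 / ((n : ℝ) + 1))} :=
      (measurable_snd hA).inter
        (measurableSet_le (measurable_snd.dist measurable_fst) measurable_const)
    exact measurable_measure_prodMk_left (ν := (volume : Measure (ℝ × ℝ))) hm
  · have hm : MeasurableSet {q : (ℝ × ℝ) × (ℝ × ℝ) |
        q.2 ∈ Metric.closedBall q.1 (1 / ((n : ℝ) + 1))} :=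
      measurableSet_le (measurable_snd.dist measurable_fst) measurable_const
    exact measurable_measure_prodMk_left (ν := (volume : Measure (ℝ × ℝ))) hm

theorem volume_closedBall_prod_real (s t ε : ℝ) :
    volume (Metric.closedBall (s, t) ε) = ENNReal.ofReal (2 * ε) * ENNReal.ofReal (2 * ε) := by
  rw [← closedBall_prod_same, Measure.volume_eq_prod, Measure.prod_prod, Real.volume_closedBall,
    Real.volume_closedBall]

/-- If almost every path `s, t, u` with `(s, t) ∈ P` and `(t, u) ∈ P` satisfies `(s, u) ∈ Q`, then
composing density points of `P` gives density points of `Q`: a path in small balls around `s, t, u`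
whose ends are not related by `Q` must leave `P` at its first or second step. -/
theorem HasDensityZeroAt.comp {P Q : Set (ℝ × ℝ)} (hQ : MeasurableSet Q)
    (h : ∀ᵐ p : ℝ × ℝ × ℝ, (p.1, p.2.1) ∈ P → (p.2.1, p.2.2) ∈ P → (p.1, p.2.2) ∈ Q)
    {s t u : ℝ} (hst : HasDensityZeroAt Pᶜ (s, t)) (htu : HasDensityZeroAt Pᶜ (t, u)) :
    HasDensityZeroAt Qᶜ (s, u) := by
  have hsum := hst.add htu
  rw [add_zero] at hsum
  refine tendsto_of_tendsto_of_tendsto_of_le_of_le tendsto_const_nhds hsum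
    (fun _ => zero_le) fun n => ?_
  have hε : (0 : ℝ) < 1 / ((n : ℝ) + 1) := by positivity
  simp only [volume_closedBall_prod_real]
  generalize 1 / ((n : ℝ) + 1) = ε at hε
  set a := ENNReal.ofReal (2 * ε)
  have ha0 : a ≠ 0 := (ENNReal.ofReal_pos.2 (by positivity)).ne'
  have hat : a ≠ ⊤ := ENNReal.ofReal_ne_top
  rw [← ENNReal.add_div]
  refine ENNReal.div_le_div_right ?_ _
  set I := Metric.closedBall s ε
  set J := Metric.closedBall t ε
  set K := Metric.closedBall u ε
  have hI : volume I = a := Real.volume_closedBall s ε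
  have hJ : volume J = a := Real.volume_closedBall t ε
  have hK : volume K = a := Real.volume_closedBall u ε
  let X : Set (ℝ × ℝ × ℝ) := {p | (p.1, p.2.2) ∈ Qᶜ ∩ Metric.closedBall (s, u) ε ∧ p.2.1 ∈ J}
  let Y : Set (ℝ × ℝ × ℝ) := {p | (p.1, p.2.1) ∈ Pᶜ ∩ Metric.closedBall (s, t) ε ∧ p.2.2 ∈ K}
  let Z : Set (ℝ × ℝ × ℝ) := {p | (p.2.1, p.2.2) ∈ Pᶜ ∩ Metric.closedBall (t, u) ε ∧ p.1 ∈ I}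
  have hXYZ : volume X ≤ volume Y + volume Z := by
    refine (measure_mono_ae ?_).trans (measure_union_le Y Z)
    filter_upwards [h] with p hp hpX
    obtain ⟨⟨hpQ, hpb⟩, hpJ⟩ := hpX
    rw [← closedBall_prod_same] at hpb
    by_cases h1 : (p.1, p.2.1) ∈ P
    · refine Or.inr ⟨⟨fun h2 => hpQ (hp h1 h2), ?_⟩, hpb.1⟩
      rw [← closedBall_prod_same]
      exact ⟨hpJ, hpb.2⟩
    · refine Or.inl ⟨⟨h1, ?_⟩, hpb.2⟩
      rw [← closedBall_prod_same]
      exact ⟨hpb.1, hpJ⟩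
  have hZ : volume Z = a * volume (Pᶜ ∩ Metric.closedBall (t, u) ε) := by
    rw [← hI, ← Measure.prod_prod]
    refine congrArg _ ?_
    ext p
    exact and_comm
  have hmY : MeasurePreserving (MeasurableEquiv.prodAssoc : (ℝ × ℝ) × ℝ ≃ᵐ ℝ × ℝ × ℝ) volume
      volume := measurePreserving_prodAssoc volume volume volume
  have hY : volume Y = volume (Pᶜ ∩ Metric.closedBall (s, t) ε) * a := by
    rw [← hK, ← Measure.prod_prod, ← hmY.measure_preimage_equiv]
    rfl
  have hmX : MeasurePreserving (fun p : ℝ × ℝ × ℝ => (p.1, p.2.swap)) volume volume :=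
    (MeasurePreserving.id volume).prod Measure.measurePreserving_swap
  have hX : volume X = volume (Qᶜ ∩ Metric.closedBall (s, u) ε) * a := by
    have hmX' : MeasurePreserving (fun p : (ℝ × ℝ) × ℝ => (p.1.1, p.2, p.1.2)) volume volume :=
      hmX.comp hmY
    have hXm : MeasurableSet X := by
      refine MeasurableSet.inter ?_ ?_
      · exact (measurable_fst.prodMk (measurable_snd.comp measurable_snd))
          (hQ.compl.inter Metric.isClosed_closedBall.measurableSet)
      · exact (measurable_fst.comp measurable_snd) Metric.isClosed_closedBall.measurableSet
    rw [← hJ, ← Measure.prod_prod, ← hmX'.measure_preimage hXm.nullMeasurableSet]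
    rfl
  rw [hX, hY, hZ, mul_comm a, ← add_mul] at hXYZ
  exact (ENNReal.mul_le_mul_iff_left ha0 hat).1 hXYZ

/-- A measurable function satisfying the kernel axioms almost everywhere agrees almost everywhere
with one satisfying them at all points: the value is set to `1` at the density points of `{U = 1}`
and to `0` off the density points of `{U > 0}`. -/
theorem exists_kernel_of_ae {U : ℝ × ℝ → ℝ} (hU : Measurable U)
    (hU1 : ∀ p, U p ∈ Set.Icc (0 : ℝ) 1) (hlt : ∀ᵐ p : ℝ × ℝ, 0 < U p → p.1 < p.2)
    (h : ∀ᵐ p : ℝ × ℝ × ℝ, 0 < U (p.1, p.2.1) → 0 < U (p.2.1, p.2.2) → U (p.1, p.2.2) = 1) :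
    ∃ U' : ℝ × ℝ → ℝ, Measurable U' ∧ (∀ p, U' p ∈ Set.Icc (0 : ℝ) 1) ∧
      (∀ p, 0 < U' p → p.1 < p.2) ∧
      (∀ s t u, 0 < U' (s, t) → 0 < U' (t, u) → U' (s, u) = 1) ∧
      ∀ᵐ p : ℝ × ℝ, U' p = U p := by
  classical
  let P : Set (ℝ × ℝ) := {p | 0 < U p}
  let Q : Set (ℝ × ℝ) := {p | U p = 1}
  have hP : MeasurableSet P := measurableSet_lt measurable_const hU
  have hQ : MeasurableSet Q := hU (measurableSet_singleton 1)
  have hQd := measurableSet_hasDensityZeroAt hQ.compl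
  have hPd := measurableSet_hasDensityZeroAt hP.compl
  have hL : MeasurableSet {p : ℝ × ℝ | p.1 < p.2} := measurableSet_lt measurable_fst measurable_snd
  let U' : ℝ × ℝ → ℝ := fun p => if p.1 < p.2 ∧ HasDensityZeroAt Pᶜ p then
    (if HasDensityZeroAt Qᶜ p then 1 else U p) else 0
  have hpos : ∀ p, 0 < U' p → p.1 < p.2 ∧ HasDensityZeroAt Pᶜ p := by
    intro p hp
    by_contra hn
    simp [U', hn] at hp
  have hQP : ∀ p, HasDensityZeroAt Qᶜ p → HasDensityZeroAt Pᶜ p := by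
    intro p hp
    refine tendsto_of_tendsto_of_tendsto_of_le_of_le tendsto_const_nhds hp
      (fun _ => zero_le) fun n => ENNReal.div_le_div_right (measure_mono ?_) _
    refine Set.inter_subset_inter_left _ (Set.compl_subset_compl.2 fun q hq => ?_)
    change 0 < U q
    rw [show U q = 1 from hq]
    exact one_pos
  refine ⟨U', ?_, ?_, fun p hp => (hpos p hp).1, ?_, ?_⟩
  · exact Measurable.ite (hL.inter hPd) (Measurable.ite hQd measurable_const hU) measurable_const
  · intro p
    simp only [U']
    split_ifs
    · exact ⟨zero_le_one, le_rfl⟩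
    · exact hU1 p
    · exact ⟨le_rfl, zero_le_one⟩
  · intro s t u hst htu
    have hQs : HasDensityZeroAt Qᶜ (s, u) :=
      HasDensityZeroAt.comp hQ h (hpos _ hst).2 (hpos _ htu).2
    have hsu : s < u := lt_trans (hpos _ hst).1 (hpos _ htu).1
    simp [U', hQs, hQP _ hQs, hsu]
  · filter_upwards [hlt, ae_hasDensityZeroAt_iff hP.compl, ae_hasDensityZeroAt_iff hQ.compl]
      with p h1 h2 h3
    rw [Set.notMem_compl_iff] at h2 h3
    by_cases hp : 0 < U p
    · have h4 : p.1 < p.2 ∧ HasDensityZeroAt Pᶜ p := ⟨h1 hp, h2.2 hp⟩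
      by_cases hq : U p = 1
      · simp [U', h4, h3.2 hq, hq]
      · simp [U', h4, show ¬ HasDensityZeroAt Qᶜ p from fun hd => hq (h3.1 hd)]
    · have h4 : ¬ (p.1 < p.2 ∧ HasDensityZeroAt Pᶜ p) := fun hd => hp (h2.1 hd.2)
      have h5 : U p = 0 := le_antisymm (not_lt.1 hp) (hU1 p).1
      simp only [U', if_neg h4, h5]

/-! ### Kernels and their representation on the unit interval -/

/-- The down-set measure `φ x = μ {z | z ◁ x}` is weakly monotone; it is strictly monotone up to a
null set of pairs. For if `x ◁ y` and `φ x = φ y`, then the down-sets of `x` and `y` agree up to a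
null set; so on the set of all such `x`, for a fixed `y`, almost all pairs are related, in both
directions. -/
theorem IsOrderedProbabilitySpace.ae_measure_down_ne {S : Type*} [MeasurableSpace S]
    {μ : Measure S} {r : S → S → Prop} (h : IsOrderedProbabilitySpace μ r) :
    ∀ᵐ p ∂(μ.prod μ), r p.1 p.2 → μ {z | r z p.1} ≠ μ {z | r z p.2} := by
  have := h.isProbabilityMeasure
  have := h.isStrictOrder
  have hr := h.measurableSet_rel
  have hr' : MeasurableSet {p : S × S | r p.2 p.1} := measurable_swap hr
  have hφ : Measurable fun x => μ {z | r z x} := measurable_measure_prodMk_left hr'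
  have hsec : ∀ y, MeasurableSet {x | r x y} := fun y => (measurable_id.prodMk measurable_const) hr
  have hm : MeasurableSet {p : S × S | r p.2 p.1 ∧ μ {z | r z p.2} = μ {z | r z p.1}} :=
    hr'.inter (measurableSet_eq_fun (hφ.comp measurable_snd) (hφ.comp measurable_fst))
  suffices hs : (μ.prod μ) {p : S × S | r p.2 p.1 ∧ μ {z | r z p.2} = μ {z | r z p.1}} = 0 by
    have h1 : ∀ᵐ p ∂(μ.prod μ), r p.2 p.1 → μ {z | r z p.2} ≠ μ {z | r z p.1} := by
      rw [ae_iff]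
      simpa using hs
    exact (Measure.measurePreserving_swap (μ := μ) (ν := μ)).quasiMeasurePreserving.ae h1
  rw [Measure.prod_apply hm]
  refine lintegral_eq_zero_of_ae_eq_zero (ae_of_all _ fun y => ?_)
  let E : Set S := {x | r x y ∧ μ {z | r z x} = μ {z | r z y}}
  have hE : MeasurableSet E := (hsec y).inter (hφ (measurableSet_singleton _))
  have hrel : (μ.prod μ) (E ×ˢ E \ {p | r p.2 p.1}) = 0 := by
    rw [Measure.prod_apply ((hE.prod hE).diff hr')]
    refine lintegral_eq_zero_of_ae_eq_zero (ae_of_all _ fun x => ?_)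
    by_cases hx : x ∈ E
    · have hsub : {z | r z x} ⊆ {z | r z y} := fun z hz => _root_.trans hz hx.1
      have h0 : μ ({z | r z y} \ {z | r z x}) = 0 := by
        rw [measure_sdiff hsub (hsec x).nullMeasurableSet (measure_ne_top μ _), hx.2, tsub_self]
      exact measure_mono_null (t := {z | r z y} \ {z | r z x})
        (fun z hz => ⟨hz.1.2.1, hz.2⟩) h0
    · exact measure_mono_null (fun z hz => hx hz.1.1) measure_empty
  have hrel' : (μ.prod μ) (E ×ˢ E \ {p | r p.1 p.2}) = 0 := by
    have := (Measure.measurePreserving_swap (μ := μ) (ν := μ)).measure_preimage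
      ((hE.prod hE).diff hr').nullMeasurableSet
    rw [hrel] at this
    refine measure_mono_null (fun p hp => ?_) this
    exact ⟨⟨hp.1.2, hp.1.1⟩, hp.2⟩
  have hEE : (μ.prod μ) (E ×ˢ E) = 0 := by
    refine measure_mono_null (fun p hp => ?_) (measure_union_null hrel hrel')
    by_cases h1 : r p.2 p.1
    · exact Or.inr ⟨hp, fun h2 => irrefl _ (_root_.trans h1 h2)⟩
    · exact Or.inl ⟨hp, h1⟩
  rw [Measure.prod_prod] at hEE
  exact mul_self_eq_zero.1 hEE

theorem IsStrictPosetKernel.rel_iff {S : Type*} [MeasurableSpace S] {μ : Measure S}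
    {r : S → S → Prop} {W : S → S → ℝ} (hW : IsStrictPosetKernel μ r W) (x y : S) :
    r x y ↔ 0 < W x y :=
  ⟨hW.pos_of_rel x y, hW.rel_of_pos x y⟩

theorem IsStrictPosetKernel.section_left_antitone {S : Type*} [MeasurableSpace S] {μ : Measure S}
    {r : S → S → Prop} {W : S → S → ℝ} (hW : IsStrictPosetKernel μ r W) {x x' : S} (h : r x x')
    (y : S) : W x' y ≤ W x y := by
  rcases (hW.mem_Icc x' y).1.eq_or_lt with h0 | h0
  · exact h0 ▸ (hW.mem_Icc x y).1
  · exact hW.eq_one_of_pos x x' y (hW.pos_of_rel _ _ h) h0 ▸ (hW.mem_Icc x' y).2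

theorem IsStrictPosetKernel.section_right_monotone {S : Type*} [MeasurableSpace S] {μ : Measure S}
    {r : S → S → Prop} {W : S → S → ℝ} (hW : IsStrictPosetKernel μ r W) (x : S) {y y' : S}
    (h : r y y') : W x y ≤ W x y' := by
  rcases (hW.mem_Icc x y).1.eq_or_lt with h0 | h0
  · exact h0 ▸ (hW.mem_Icc x y').1
  · exact hW.eq_one_of_pos x y y' h0 (hW.pos_of_rel _ _ h) ▸ (hW.mem_Icc x y).2

/-- An almost order-preserving map to `[0, 1]` together with a function of two variables which
pulls back to the kernel; this function is not yet a kernel itself. -/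
theorem IsStrictPosetKernel.exists_measurePreserving_factor {S : Type*} [MeasurableSpace S]
    {μ : Measure S} {r : S → S → Prop} {W : S → S → ℝ} (hW : IsStrictPosetKernel μ r W)
    (hμ : IsAtomless μ) :
    ∃ (f : S → unitInterval) (U : unitInterval × unitInterval → ℝ),
      MeasurePreserving f μ volume ∧ (∀ᵐ p ∂(μ.prod μ), r p.1 p.2 → f p.1 < f p.2) ∧
      Measurable U ∧ ∀ᵐ p ∂(μ.prod μ), W p.1 p.2 = U (f p.1, f p.2) := by
  have := hW.isProbabilityMeasure
  obtain ⟨g, V₀, hg, hV₀, hg0, hWV₀⟩ := hμ.exists_factor hW.measurable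
  let V : (ℕ → Bool) × (ℕ → Bool) → ℝ := fun c => max 0 (min 1 (V₀ c))
  have hV : Measurable V := measurable_const.max (measurable_const.min hV₀)
  have hWV : ∀ x y, W x y = V (g x, g y) := fun x y => by
    have h1 : W x y = V₀ (g x, g y) := congrFun hWV₀ (x, y)
    obtain ⟨h2, h3⟩ := hW.mem_Icc x y
    rw [h1] at h2 h3
    simp only [V, h1, min_eq_right h3, max_eq_right h2]
  have hV1 : ∀ c, |V c| ≤ 1 := fun c => by
    rw [abs_of_nonneg (le_max_left _ _)]
    exact max_le zero_le_one (min_le_left _ _)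
  obtain ⟨Φ, hΦ, hΦ1, hΦr, hΦu⟩ := exists_monotone_capturing_antitone μ r hg
  obtain ⟨f, k, hf, hΦf, hk, hΦk⟩ := exists_measurePreserving_unitInterval μ hΦ hΦ1
    (h := fun x => Cardinal.cantorFunction (1 / 3) (g x) / 2)
    ((measurable_cantorFunction_third.comp hg).div_const 2)
    (fun x => by
      obtain ⟨h1, h2⟩ := cantorFunction_third_mem_Icc (g x)
      constructor <;> linarith)
    (fun t => by
      rcases Set.eq_empty_or_nonempty
        ((fun x => Cardinal.cantorFunction (1 / 3) (g x) / 2) ⁻¹' {t}) with he | ⟨x₀, hx₀⟩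
      · rw [he, measure_empty]
      · refine measure_mono_null (fun x hx => ?_) (hg0 (g x₀))
        have hxx : Cardinal.cantorFunction (1 / 3) (g x) / 2 =
            Cardinal.cantorFunction (1 / 3) (g x₀) / 2 := Eq.trans hx (Eq.symm hx₀)
        exact cantorFunction_third_injective (by linarith))
  have hfac : ∀ u : (ℕ → Bool) → ℝ, Measurable u → (∃ C, ∀ c, |u c| ≤ C) →
      (∀ x y, r x y → u (g y) ≤ u (g x)) →
      ∃ w : unitInterval → ℝ, Measurable w ∧ (fun x => u (g x)) =ᵐ[μ] fun x => w (f x) := by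
    intro u hu hC hanti
    obtain ⟨w, hw, hwe⟩ := hΦu u hu hC hanti
    refine ⟨fun t => w (k t), hw.comp hk, ?_⟩
    filter_upwards [hwe, hΦk] with x h1 h2
    rw [h1, h2]
  -- strictness makes the kernel antitone in its first and monotone in its second variable
  obtain ⟨U, hU, hUe⟩ := exists_measurable_of_sections (μ := μ) hf.measurable hg hV hV1
    (fun y => hfac (fun c => V (c, g y)) (hV.comp (measurable_id.prodMk measurable_const))
      ⟨1, fun c => hV1 _⟩ fun x x' hx => by
        rw [← hWV, ← hWV]; exact hW.section_left_antitone hx y)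
    (fun x => by
      obtain ⟨w, hw, hwe⟩ := hfac (fun c => - V (g x, c))
        (hV.comp (measurable_const.prodMk measurable_id)).neg
        ⟨1, fun c => (abs_neg _).trans_le (hV1 _)⟩ fun y y' hy => by
          rw [← hWV, ← hWV]; exact neg_le_neg (hW.section_right_monotone x hy)
      refine ⟨fun t => - w t, hw.neg, ?_⟩
      filter_upwards [hwe] with y hy
      rw [← hy, neg_neg])
  refine ⟨f, U, hf, ?_, hU, hUe.mono fun p hp => (hWV _ _).trans hp⟩
  -- the down-set measure is captured by `Φ`, so `Φ` is almost everywhere strictly monotone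
  let φ : (ℕ → Bool) → ℝ := fun c => μ.real {z | 0 < V (g z, c)}
  have hφ : Measurable φ := by
    have hm : MeasurableSet {q : (ℕ → Bool) × S | 0 < V (g q.2, q.1)} :=
      measurableSet_lt measurable_const
        (hV.comp ((hg.comp measurable_snd).prodMk measurable_fst))
    exact (measurable_measure_prodMk_left hm).ennreal_toReal
  have hφr : ∀ x, φ (g x) = μ.real {z | r z x} := fun x => by
    simp only [φ, hW.rel_iff, hWV]
  have := hW.isStrictOrder
  obtain ⟨w, -, hwe⟩ := hΦu (fun c => - φ c) hφ.neg
    ⟨1, fun c => by rw [abs_neg, abs_of_nonneg measureReal_nonneg]; exact measureReal_le_one⟩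
    fun x y hxy => by
      rw [hφr, hφr]
      exact neg_le_neg (measureReal_mono fun z (hz : r z x) => _root_.trans hz hxy)
  have hw1 := (Measure.quasiMeasurePreserving_fst (μ := μ) (ν := μ)).ae hwe
  have hw2 := (Measure.quasiMeasurePreserving_snd (μ := μ) (ν := μ)).ae hwe
  have hne : ∀ᵐ p ∂(μ.prod μ), f p.1 ≠ f p.2 := by
    have hm : MeasurableSet {p : S × S | f p.1 = f p.2} :=
      measurableSet_eq_fun (hf.measurable.comp measurable_fst) (hf.measurable.comp measurable_snd)
    refine (Measure.ae_prod_iff_ae_ae hm.compl).2 (ae_of_all _ fun x => ?_)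
    have h0 : μ (f ⁻¹' {f x}) = 0 := by
      rw [hf.measure_preimage (measurableSet_singleton _).nullMeasurableSet, measure_singleton]
    rw [ae_iff]
    exact measure_mono_null (fun y hy => (not_not.1 hy).symm) h0
  filter_upwards [hW.ae_measure_down_ne, hw1, hw2, hne] with p h1 h2 h3 h4 hp
  have hΦne : Φ p.1 ≠ Φ p.2 := by
    intro he
    refine h1 hp ?_
    have h5 : φ (g p.1) = φ (g p.2) := neg_injective (by rw [h2, h3, he])
    rw [hφr, hφr] at h5
    exact (measureReal_eq_measureReal_iff).1 h5
  exact lt_of_le_of_ne (hΦf _ _ (lt_of_le_of_ne (hΦr _ _ hp) hΦne)) h4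

theorem mainTheorem2 {S : Type*} [MeasurableSpace S] (μ : Measure S) (r : S → S → Prop)
    (W : S → S → ℝ) (hW : IsStrictPosetKernel μ r W) (hμ : IsAtomless μ) :
    ∃ (U : unitInterval → unitInterval → ℝ) (f : S → unitInterval),
      IsPosetKernel (volume : Measure unitInterval) (· < ·) U ∧
      IsInclusion μ r (volume : Measure unitInterval) (· < ·) f ∧
      ∀ᵐ p ∂(μ.prod μ), W p.1 p.2 = kernelPullback U f p.1 p.2 := by
  have := hW.isProbabilityMeasure
  obtain ⟨f, U₀, hf, hfr, hU₀, hWU₀⟩ := hW.exists_measurePreserving_factor hμ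
  let F : S → ℝ := fun x => f x
  have hF : MeasurePreserving F μ (volume.restrict (Set.Icc 0 1)) :=
    unitInterval.measurePreserving_coe.comp hf
  have hF2 := hF.prod hF
  have hF3 := hF.prod hF2
  -- extend by zero to the plane, where the density theorem is available
  let pr : ℝ → unitInterval := Set.projIcc 0 1 zero_le_one
  have hpr : Measurable pr := continuous_projIcc.measurable
  have hprF : ∀ x, pr (F x) = f x := fun x => Set.projIcc_val zero_le_one (f x)
  have hI2 : MeasurableSet (Set.Icc (0 : ℝ) 1 ×ˢ Set.Icc (0 : ℝ) 1) :=
    measurableSet_Icc.prod measurableSet_Icc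
  let U₁ : ℝ × ℝ → ℝ := (Set.Icc (0 : ℝ) 1 ×ˢ Set.Icc (0 : ℝ) 1).indicator
    fun p => max 0 (min 1 (U₀ (pr p.1, pr p.2)))
  have hU₁ : Measurable U₁ := (measurable_const.max (measurable_const.min (hU₀.comp
    ((hpr.comp measurable_fst).prodMk (hpr.comp measurable_snd))))).indicator hI2
  have hU₁1 : ∀ p, U₁ p ∈ Set.Icc (0 : ℝ) 1 := fun p => by
    by_cases hp : p ∈ Set.Icc (0 : ℝ) 1 ×ˢ Set.Icc (0 : ℝ) 1
    · simp only [U₁, Set.indicator_of_mem hp]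
      exact ⟨le_max_left _ _, max_le zero_le_one (min_le_left _ _)⟩
    · simp only [U₁, Set.indicator_of_notMem hp]
      exact ⟨le_rfl, zero_le_one⟩
  have hsupp : ∀ p, 0 < U₁ p → p.1 ∈ Set.Icc (0 : ℝ) 1 ∧ p.2 ∈ Set.Icc (0 : ℝ) 1 := fun p hp => by
    by_contra hn
    have hn' : p ∉ Set.Icc (0 : ℝ) 1 ×ˢ Set.Icc (0 : ℝ) 1 := hn
    simp only [U₁, Set.indicator_of_notMem hn', lt_irrefl] at hp
  have hWU₁ : ∀ᵐ p ∂(μ.prod μ), W p.1 p.2 = U₁ (F p.1, F p.2) := by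
    filter_upwards [hWU₀] with p hp
    have hm : (F p.1, F p.2) ∈ Set.Icc (0 : ℝ) 1 ×ˢ Set.Icc (0 : ℝ) 1 := ⟨(f p.1).2, (f p.2).2⟩
    obtain ⟨h1, h2⟩ := hW.mem_Icc p.1 p.2
    rw [hp] at h1 h2
    simp only [U₁, Set.indicator_of_mem hm, hprF, min_eq_right h2, max_eq_right h1, hp]
  have hlt : ∀ᵐ p : ℝ × ℝ, 0 < U₁ p → p.1 < p.2 := by
    have hm : MeasurableSet {p : ℝ × ℝ | 0 < U₁ p → p.1 < p.2} :=
      (measurableSet_lt measurable_const hU₁).himp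
        (measurableSet_lt measurable_fst measurable_snd)
    have h1 : ∀ᵐ p ∂((volume.restrict (Set.Icc (0 : ℝ) 1)).prod
        (volume.restrict (Set.Icc (0 : ℝ) 1))), 0 < U₁ p → p.1 < p.2 := by
      rw [← hF2.map_eq, ae_map_iff hF2.measurable.aemeasurable hm]
      filter_upwards [hWU₁, hfr] with p hp1 hp2 hp
      exact hp2 ((hW.rel_iff _ _).2 (hp1 ▸ hp))
    rw [Measure.prod_restrict, ← Measure.volume_eq_prod, ae_restrict_iff' hI2] at h1
    filter_upwards [h1] with p hp hpos
    exact hp (hsupp p hpos) hpos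
  -- the kernel axioms hold everywhere on `S`, hence almost everywhere on `[0, 1]`
  have htri : ∀ᵐ p : ℝ × ℝ × ℝ, 0 < U₁ (p.1, p.2.1) → 0 < U₁ (p.2.1, p.2.2) →
      U₁ (p.1, p.2.2) = 1 := by
    have hm12 : Measurable fun p : ℝ × ℝ × ℝ => U₁ (p.1, p.2.1) :=
      hU₁.comp (measurable_fst.prodMk (measurable_fst.comp measurable_snd))
    have hm23 : Measurable fun p : ℝ × ℝ × ℝ => U₁ (p.2.1, p.2.2) := hU₁.comp measurable_snd
    have hm13 : Measurable fun p : ℝ × ℝ × ℝ => U₁ (p.1, p.2.2) :=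
      hU₁.comp (measurable_fst.prodMk (measurable_snd.comp measurable_snd))
    have hm : MeasurableSet {p : ℝ × ℝ × ℝ | 0 < U₁ (p.1, p.2.1) → 0 < U₁ (p.2.1, p.2.2) →
        U₁ (p.1, p.2.2) = 1} :=
      (measurableSet_lt measurable_const hm12).himp
        ((measurableSet_lt measurable_const hm23).himp (hm13 (measurableSet_singleton 1)))
    have h1 : ∀ᵐ p ∂((volume.restrict (Set.Icc (0 : ℝ) 1)).prod
        ((volume.restrict (Set.Icc (0 : ℝ) 1)).prod (volume.restrict (Set.Icc (0 : ℝ) 1)))),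
        0 < U₁ (p.1, p.2.1) → 0 < U₁ (p.2.1, p.2.2) → U₁ (p.1, p.2.2) = 1 := by
      rw [← hF3.map_eq, ae_map_iff hF3.measurable.aemeasurable hm]
      have e12 := ((MeasurePreserving.id μ).prod
        (measurePreserving_fst (μ := μ) (ν := μ))).quasiMeasurePreserving.ae hWU₁
      have e13 := ((MeasurePreserving.id μ).prod
        (measurePreserving_snd (μ := μ) (ν := μ))).quasiMeasurePreserving.ae hWU₁
      have e23 := (measurePreserving_snd (μ := μ) (ν := μ.prod μ)).quasiMeasurePreserving.ae hWU₁
      filter_upwards [e12, e13, e23] with p h12 h13 h23 hp12 hp23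
      refine Eq.trans h13.symm (hW.eq_one_of_pos _ p.2.1 _ ?_ ?_)
      · exact lt_of_lt_of_eq hp12 h12.symm
      · exact lt_of_lt_of_eq hp23 h23.symm
    rw [Measure.prod_restrict, Measure.prod_restrict, ← Measure.volume_eq_prod,
      ← Measure.volume_eq_prod, ae_restrict_iff' (measurableSet_Icc.prod hI2)] at h1
    filter_upwards [h1] with p hp h12 h23
    exact hp ⟨(hsupp _ h12).1, (hsupp _ h12).2, (hsupp _ h23).2⟩ h12 h23
  obtain ⟨U, hU, hU1, hUlt, hUtri, hUe⟩ := exists_kernel_of_ae hU₁ hU₁1 hlt htri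
  refine ⟨fun s t => U (s, t), f, ⟨⟨inferInstance, inferInstance, ?_⟩, ?_, fun s t => hU1 _,
    fun s t h => hUlt _ h, fun s t u => hUtri s t u⟩, ⟨hf, ?_⟩, ?_⟩
  · exact measurableSet_lt measurable_fst measurable_snd
  · exact hU.comp ((measurable_subtype_coe.comp measurable_fst).prodMk
      (measurable_subtype_coe.comp measurable_snd))
  · rw [ae_iff] at hfr
    simpa using hfr
  · have h1 : ∀ᵐ p ∂((volume.restrict (Set.Icc (0 : ℝ) 1)).prod
        (volume.restrict (Set.Icc (0 : ℝ) 1))), U p = U₁ p := by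
      rw [Measure.prod_restrict, ← Measure.volume_eq_prod]
      exact ae_restrict_of_ae hUe
    filter_upwards [hWU₁, hF2.quasiMeasurePreserving.ae h1] with p hp1 hp2
    exact hp1.trans hp2.symm
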